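/- Let $d\ge 2$. For points $p_0,\dots,p_n\in\mathbb{R}^d$ ($n\ge 1$), the polygonal path $p_0p_1\cdots p_n$ is the curve $\gamma:[0,n]\to\mathbb{R}^d$ that traverses the edges $p_0p_1,\dots,p_{n-1}p_n$ linearly, one per unit parameter interval. It is in general position if any $k\le d+1$ of its vertices $p_0,\dots,p_n$ are affinely independent. It is $k$-crossing if for every hyperplane $h$ that contains none of its edges there are at most $k$ parameters $t\in[0,n]$ with $\gamma(t)\in h$; a $d$-crossing path is called convex. A $k$-sequence is a finite sequence of distinct elements together with a sign $\pm1$ for every $(k+1)$-element set of its elements. It is a flip $k$-sequence if for every $k$-element set $A$ the sequence of the signs of $A\cup\{a\}$, where $a$ runs through the elements outside $A$ in their order, has at most one sign change. Its greedy partition consists of consecutive blocks, any two successive ones sharing exactly one element, in which each block is the longest one from its starting point on which all $(k+1)$-element sets have the same sign. Theorem. For every $d\ge2$ there is an integer $M=M(d)$ such that every $(d+1)$-crossing polygonal path $p_0p_1\cdots p_n$ in general position in $\mathbb{R}^d$ can be subdivided at vertices into at most $M$ convex polygonal paths: there are $m\le M$ and $0=i_0<i_1<\dots<i_m=n$ such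 that each path $p_{i_{j-1}}p_{i_{j-1}+1}\cdots p_{i_j}$, $1\le j\le m$, is convex. Moreover, $M(d)$ can be chosen so that $M(d)\le c$ for every integer $c$ such that the greedy partition of every flip $d$-sequence has at most $c$ blocks, and so that $M(d)\le c(d)$, where $c(1)=3$ and $c(k)=1+\frac{(4k+10)\,c(k-1)}{k}$ for $k\ge2$. -/

import Mathlib

/-- The polygonal path with vertices `p 0, p 1, …, p n`, as a curve: at the parameter
`t ∈ [i, i + 1]` it is the point of the edge from `p i` to `p (i + 1)` at proportion `t - i`.
Only the parameters `t ∈ [0, n]` matter, and there the values `p i` with `i > n` play no role. -/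
noncomputable def polyPath {d : ℕ} (p : ℕ → EuclideanSpace ℝ (Fin d)) (t : ℝ) :
    EuclideanSpace ℝ (Fin d) :=
  AffineMap.lineMap (p ⌊t⌋₊) (p (⌊t⌋₊ + 1)) (t - (⌊t⌋₊ : ℝ))

/-- The points `p 0, …, p n` of `ℝ^d` are in general position: any `k ≤ d + 1` of them are
affinely independent. -/
def InGeneralPosition {d : ℕ} (p : ℕ → EuclideanSpace ℝ (Fin d)) (n : ℕ) : Prop :=
  ∀ s : Finset ℕ, s ⊆ Finset.range (n + 1) → s.card ≤ d + 1 →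
    AffineIndependent ℝ (fun i : s => p (i : ℕ))

/-- The hyperplane `{x | ⟨u, x⟩ = c}` (to be used with `u ≠ 0`). -/
def hyperplane {d : ℕ} (u : EuclideanSpace ℝ (Fin d)) (c : ℝ) :
    Set (EuclideanSpace ℝ (Fin d)) :=
  {x | inner ℝ u x = c}

/-- The polygonal path with vertices `p a, p (a + 1), …, p b` is `k`-crossing: it intersects every
hyperplane that contains none of its edges at most `k` times. Intersections are counted with
multiplicity, that is, as parameter values. -/
def IsCrossing {d : ℕ} (k : ℕ) (p : ℕ → EuclideanSpace ℝ (Fin d)) (a b : ℕ) : Prop :=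
  ∀ (u : EuclideanSpace ℝ (Fin d)) (c : ℝ), u ≠ 0 →
    (∀ i : ℕ, a ≤ i → i < b → ¬ segment ℝ (p i) (p (i + 1)) ⊆ hyperplane u c) →
    {t : ℝ | t ∈ Set.Icc (a : ℝ) (b : ℝ) ∧ polyPath p t ∈ hyperplane u c}.encard ≤ (k : ℕ∞)

/-- `0 = e 0 < e 1 < ⋯ < e m = n`: a division of the index interval `[0, n]` into the `m`
consecutive intervals `[e j, e (j + 1)]`, `j < m`, which overlap in one index. -/
def IsDivision (n m : ℕ) (e : ℕ → ℕ) : Prop :=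
  e 0 = 0 ∧ e m = n ∧ ∀ j < m, e j < e (j + 1)

/-- Every `(d + 1)`-crossing polygonal path in general position in `ℝ^d` (with at least one edge)
can be subdivided, at vertices, into at most `M` convex (`d`-crossing) polygonal paths. -/
def SubdivisionBound (d M : ℕ) : Prop :=
  ∀ (n : ℕ) (p : ℕ → EuclideanSpace ℝ (Fin d)), 1 ≤ n → InGeneralPosition p n →
    IsCrossing (d + 1) p 0 n →
    ∃ m ≤ M, ∃ e : ℕ → ℕ, IsDivision n m e ∧ ∀ j < m, IsCrossing d p (e j) (e (j + 1))

/-- A `k`-sequence consists of elements indexed by `0, …, n` and of a sign for every set of `k + 1`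
of them (the values of `sgn` on other sets play no role). It is a flip `k`-sequence if for every
`k`-element set `A` the sequence of the signs of `A ∪ {i}`, for `i ∉ A` in increasing order,
has at most one sign change. -/
def IsFlipSeq (k n : ℕ) (sgn : Finset ℕ → ℤˣ) : Prop :=
  ∀ A : Finset ℕ, A ⊆ Finset.range (n + 1) → A.card = k →
    ∀ i j l : ℕ, i < j → j < l → l ≤ n → i ∉ A → j ∉ A → l ∉ A →
      ¬ (sgn (insert i A) ≠ sgn (insert j A) ∧ sgn (insert j A) ≠ sgn (insert l A))

/-- All `(k + 1)`-element subsets of `{a, a + 1, …, b}` have the same sign. -/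
def IsHomogeneous (k : ℕ) (sgn : Finset ℕ → ℤˣ) (a b : ℕ) : Prop :=
  ∃ σ : ℤˣ, ∀ A : Finset ℕ, A ⊆ Finset.Icc a b → A.card = k + 1 → sgn A = σ

/-- `e` describes the greedy partition of the `k`-sequence, with `m` blocks
`{e j, …, e (j + 1)}`, `j < m`: every block is homogeneous, and every block but the last one, which
ends in `n`, would stop being so if it were extended by the next element. -/
def IsGreedyPartition (k n : ℕ) (sgn : Finset ℕ → ℤˣ) (m : ℕ) (e : ℕ → ℕ) : Prop :=
  IsDivision n m e ∧ (∀ j < m, IsHomogeneous k sgn (e j) (e (j + 1))) ∧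
    ∀ j, j + 1 < m → ¬ IsHomogeneous k sgn (e j) (e (j + 1) + 1)

/-- The greedy partition of every flip `k`-sequence (of at least two elements) has at most `c`
blocks. -/
def FlipBound (k c : ℕ) : Prop :=
  ∀ (n : ℕ) (sgn : Finset ℕ → ℤˣ), 1 ≤ n → IsFlipSeq k n sgn →
    ∀ (m : ℕ) (e : ℕ → ℕ), IsGreedyPartition k n sgn m e → m ≤ c

/-- The explicit bound: `c(1) = 3` and `c(k) = 1 + (4k + 10) c(k - 1) / k` for `k ≥ 2`
(the value at `0` is not used). -/
def explicitBound : ℕ → ℚ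
  | 0 => 0
  | 1 => 3
  | k + 2 => 1 + (4 * ((k : ℚ) + 2) + 10) * explicitBound (k + 1) / ((k : ℚ) + 2)

/-!
The constant is the least `c` such that the greedy partition of every flip `d`-sequence has at most
`c` blocks. There are two things to show.

*Such a `c` exists and is at most `explicitBound d`.* Consider disjoint intervals in a flip
`k`-sequence none of which is homogeneous. Each of them contains a `k`-element set `A` such that the
signs of `A ∪ {z}` have a constant value `η` for `z` to the left of the interval and `-η` to the right
(`IsFlipOn.exists_switch`). The link of the first element `x`, that is, the signs of `B ∪ {x}`, is a
flip `(k - 1)`-sequence, and any two of the intervals to the right of `x` together are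
non-homogeneous in it (`IsFlipOn.not_isHomogeneous_link`). This is clear if their values of `η`
differ. If they agree, exchange the set `A` of the first interval for the set `B` of the second one,
element by element: the `(k + 1)`-element sets met on the way have sign `-η` at first and `η` at the
end, and where the sign changes the flip property forces the sign `-η` on the current `k`-element set
together with `x`, whereas `A ∪ {x}` has the sign `η`. So the number of disjoint non-homogeneous
intervals at most doubles, up to an additive constant, from `k - 1` to `k`
(`IsFlipOn.card_not_isHomogeneous_le`), and the blocks of a greedy partition number at most
`6 * 2 ^ k - 3` (`flipBound_of_two_le`).

*It bounds the subdivision.* The orientations of the `(d + 1)`-element sets of vertices of a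
`(d + 1)`-crossing path form a flip `d`-sequence: otherwise a hyperplane through `d` vertices could
be tilted so as to separate `d + 3` vertices alternately (`isFlipSeq_orientSign`). A block on which
all orientations agree is convex: by multilinearity of the determinant `d + 1` points on different
edges are affinely independent (`isCrossing_of_isHomogeneous`). So the greedy partition of the
sequence of orientations is a subdivision into convex paths.
-/

/-! ### Flip sequences and their links -/

/-- The flip property for the elements `lo, …, n` only: for every set `A` of `k` of them, the signs
of `A ∪ {i}`, for `i ∉ A` in increasing order, change at most once. -/
def IsFlipOn (k lo n : ℕ) (sgn : Finset ℕ → ℤˣ) : Prop :=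
  ∀ A : Finset ℕ, A ⊆ Finset.Icc lo n → A.card = k →
    ∀ i j l : ℕ, lo ≤ i → i < j → j < l → l ≤ n → i ∉ A → j ∉ A → l ∉ A →
      ¬ (sgn (insert i A) ≠ sgn (insert j A) ∧ sgn (insert j A) ≠ sgn (insert l A))

theorem Int.units_eq_of_ne_of_ne {a b c : ℤˣ} (h : a ≠ b) (h' : b ≠ c) : a = c := by
  rcases Int.units_eq_one_or a with rfl | rfl <;> rcases Int.units_eq_one_or b with rfl | rfl <;>
    rcases Int.units_eq_one_or c with rfl | rfl <;> simp_all

theorem IsFlipSeq.isFlipOn {k n : ℕ} {sgn : Finset ℕ → ℤˣ} (h : IsFlipSeq k n sgn) :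
    IsFlipOn k 0 n sgn := by
  intro A hA hc i j l _ hij hjl hl
  refine h A (fun a ha => ?_) hc i j l hij hjl hl
  have := Finset.mem_Icc.1 (hA ha)
  exact Finset.mem_range.2 (by omega)

/-- The link of the first element of a flip sequence is a flip sequence. -/
theorem IsFlipOn.link {k lo n : ℕ} {sgn : Finset ℕ → ℤˣ} (h : IsFlipOn (k + 1) lo n sgn)
    (hlo : lo ≤ n) : IsFlipOn k (lo + 1) n (fun B => sgn (insert lo B)) := by
  intro A hA hc i j l hi hij hjl hl hiA hjA hlA
  have hloA : lo ∉ A := fun hm => by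
    have := Finset.mem_Icc.1 (hA hm)
    omega
  have := h (insert lo A) ?_ (by rw [Finset.card_insert_of_notMem hloA, hc]) i j l (by omega) hij
    hjl hl (by simp [hiA]; omega) (by simp [hjA]; omega) (by simp [hlA]; omega)
  · simpa only [Finset.insert_comm lo] using this
  · intro a ha
    rcases Finset.mem_insert.1 ha with rfl | ha
    · exact Finset.mem_Icc.2 ⟨le_rfl, hlo⟩
    · have := Finset.mem_Icc.1 (hA ha)
      exact Finset.mem_Icc.2 (by omega)

/-- Any two `(k + 1)`-element sets are joined by exchanges of single elements, so two different
signs in an interval are already found on two sets that differ in one element. -/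
theorem exists_exchange_of_not_isHomogeneous {k a b : ℕ} {sgn : Finset ℕ → ℤˣ}
    (h : ¬ IsHomogeneous k sgn a b) :
    ∃ A ⊆ Finset.Icc a b, A.card = k ∧ ∃ i ∈ Finset.Icc a b, ∃ j ∈ Finset.Icc a b,
      i < j ∧ i ∉ A ∧ j ∉ A ∧ sgn (insert i A) ≠ sgn (insert j A) := by
  by_contra! hcon
  have swap : ∀ A ⊆ Finset.Icc a b, A.card = k → ∀ i ∈ Finset.Icc a b, ∀ j ∈ Finset.Icc a b,
      i ∉ A → j ∉ A → sgn (insert i A) = sgn (insert j A) := by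
    intro A hA hc i hi j hj hiA hjA
    rcases lt_trichotomy i j with hij | rfl | hij
    · exact hcon A hA hc i hi j hj hij hiA hjA
    · rfl
    · exact (hcon A hA hc j hj i hi hij hjA hiA).symm
  have key : ∀ N : ℕ, ∀ B ⊆ Finset.Icc a b, ∀ B' ⊆ Finset.Icc a b, B.card = k + 1 →
      B'.card = k + 1 → (B \ B').card = N → sgn B = sgn B' := by
    intro N
    induction N with
    | zero =>
      intro B _ B' _ hc hc' h0
      rw [Finset.card_eq_zero, Finset.sdiff_eq_empty_iff_subset] at h0
      rw [Finset.eq_of_subset_of_card_le h0 (by omega)]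
    | succ N ih =>
      intro B hB B' hB' hc hc' hN
      obtain ⟨x, hx⟩ : (B \ B').Nonempty := Finset.card_pos.1 (by omega)
      obtain ⟨y, hy⟩ : (B' \ B).Nonempty := by
        rw [← Finset.card_pos, Finset.card_sdiff_comm (hc'.trans hc.symm)]
        omega
      rw [Finset.mem_sdiff] at hx hy
      have hyE : y ∉ B.erase x := fun hm => hy.2 (Finset.mem_of_mem_erase hm)
      have hE : B.erase x ⊆ Finset.Icc a b := (Finset.erase_subset _ _).trans hB
      have hEc : (B.erase x).card = k := by rw [Finset.card_erase_of_mem hx.1, hc]; rfl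
      have h1 := swap (B.erase x) hE hEc x (hB hx.1) y (hB' hy.1) (by simp) hyE
      rw [Finset.insert_erase hx.1] at h1
      rw [h1]
      refine ih _ (Finset.insert_subset (hB' hy.1) hE) B' hB' ?_ hc' ?_
      · rw [Finset.card_insert_of_notMem hyE, hEc]
      · rw [Finset.insert_sdiff_of_mem _ hy.1, Finset.erase_sdiff_comm,
          Finset.card_erase_of_mem (Finset.mem_sdiff.2 hx), hN]
        rfl
  apply h
  by_cases hex : ∃ B ⊆ Finset.Icc a b, B.card = k + 1
  · obtain ⟨B, hB, hc⟩ := hex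
    exact ⟨sgn B, fun A hA hAc => key _ A hA B hB hAc hc rfl⟩
  · exact ⟨1, fun A hA hAc => (hex ⟨A, hA, hAc⟩).elim⟩

/-- In a non-homogeneous interval `[a, b]` of a flip sequence there are `k` elements `A` such that
the signs of `A ∪ {z}` are constant to the left and to the right of the interval, with opposite
values. -/
theorem IsFlipOn.exists_switch {k lo n a b : ℕ} {sgn : Finset ℕ → ℤˣ} (h : IsFlipOn k lo n sgn)
    (ha : lo ≤ a) (hb : b ≤ n) (hab : ¬ IsHomogeneous k sgn a b) :
    ∃ A ⊆ Finset.Icc a b, A.card = k ∧ ∃ η : ℤˣ,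
      (∀ z, lo ≤ z → z < a → sgn (insert z A) = η) ∧
      (∀ z, b < z → z ≤ n → sgn (insert z A) = -η) := by
  obtain ⟨A, hA, hc, i, hi, j, hj, hij, hiA, hjA, hne⟩ := exists_exchange_of_not_isHomogeneous hab
  rw [Finset.mem_Icc] at hi hj
  have hA' : A ⊆ Finset.Icc lo n := hA.trans (Finset.Icc_subset_Icc ha hb)
  have hout : ∀ z, (z < a ∨ b < z) → z ∉ A := fun z hz hm => by
    have := Finset.mem_Icc.1 (hA hm)
    omega
  refine ⟨A, hA, hc, sgn (insert i A), fun z hz hza => ?_, fun z hbz hz => ?_⟩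
  -- The change between `i` and `j` is the only one in the row of `A`.
  · by_contra hcon
    exact h A hA' hc z i j hz (by omega) hij (by omega) (hout z (.inl hza)) hiA hjA ⟨hcon, hne⟩
  · by_contra hcon
    refine h A hA' hc i j z (by omega) hij (by omega) hz hiA hjA (hout z (.inr hbz)) ⟨hne, ?_⟩
    intro heq
    rw [← heq] at hcon
    exact hcon ((Int.units_ne_iff_eq_neg).1 hne.symm)

/-- The heart of the induction: in the link of the first element, two consecutive non-homogeneous
intervals merge into a non-homogeneous one. -/
theorem IsFlipOn.not_isHomogeneous_link {k lo n a b a' b' : ℕ} {sgn : Finset ℕ → ℤˣ}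
    (h : IsFlipOn (k + 1) lo n sgn) (ha : lo < a) (hba : b < a') (hb : b' ≤ n)
    (hab : ¬ IsHomogeneous (k + 1) sgn a b) (hab' : ¬ IsHomogeneous (k + 1) sgn a' b') :
    ¬ IsHomogeneous k (fun B => sgn (insert lo B)) a b' := by
  rintro ⟨σ, hσ⟩
  have hle : ∀ {u v : ℕ}, ¬ IsHomogeneous (k + 1) sgn u v → u ≤ v := fun {u v} huv => by
    obtain ⟨A, -, -, i, hi, -⟩ := exists_exchange_of_not_isHomogeneous huv
    have := Finset.mem_Icc.1 hi
    omega
  have hab1 := hle hab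
  have hab1' := hle hab'
  obtain ⟨A, hA, hc, η, hl, hr⟩ := h.exists_switch ha.le (by omega) hab
  obtain ⟨B, hB, hc', η', hl', hr'⟩ := h.exists_switch (by omega) hb hab'
  have hη : η = σ := by
    rw [← hl lo le_rfl ha]
    exact hσ A (hA.trans (Finset.Icc_subset_Icc le_rfl (by omega))) hc
  have hη' : η' = σ := by
    rw [← hl' lo le_rfl (by omega)]
    exact hσ B (hB.trans (Finset.Icc_subset_Icc (by omega) le_rfl)) hc'
  subst hη hη'
  -- `C t` consists of the elements of `A` with index at least `t` and of `B` with index below `t`.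
  set α := A.orderEmbOfFin hc with hα
  set β := B.orderEmbOfFin hc' with hβ
  have hαA : ∀ i, α i ∈ Finset.Icc a b := fun i => hA (A.orderEmbOfFin_mem hc i)
  have hβB : ∀ i, β i ∈ Finset.Icc a' b' := fun i => hB (B.orderEmbOfFin_mem hc' i)
  have hαβ : ∀ i j, α i < β j := fun i j => by
    have := Finset.mem_Icc.1 (hαA i)
    have := Finset.mem_Icc.1 (hβB j)
    omega
  let γ : ℕ → Fin (k + 1) → ℕ := fun t i => if i.1 < t then β i else α i
  have hγ : ∀ t, Function.Injective (γ t) := by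
    intro t i j hij
    simp only [γ] at hij
    have h1 := hαβ i j
    have h2 := hαβ j i
    split_ifs at hij
    · exact β.injective hij
    · omega
    · omega
    · exact α.injective hij
  let C : ℕ → Finset ℕ := fun t => Finset.univ.image (γ t)
  have hCc : ∀ t, (C t).card = k + 1 := fun t => by
    simp [C, Finset.card_image_of_injective _ (hγ t)]
  have hCsub : ∀ t, C t ⊆ Finset.Icc a b' := by
    intro t z hz
    obtain ⟨i, -, rfl⟩ := Finset.mem_image.1 hz
    have := Finset.mem_Icc.1 (hαA i)
    have := Finset.mem_Icc.1 (hβB i)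
    simp only [γ]
    rw [Finset.mem_Icc]
    split_ifs <;> omega
  have hC0 : C 0 = A := by
    simp only [C, γ, Nat.not_lt_zero, if_false]
    exact Finset.image_orderEmbOfFin_univ A hc
  have hCk : C (k + 1) = B := by
    have : γ (k + 1) = β := by
      funext i
      exact if_pos i.2
    simp only [C, this]
    exact Finset.image_orderEmbOfFin_univ B hc'
  have hstep : ∀ t : Fin (k + 1), insert (β t) (C t) = insert (α t) (C (t + 1)) := by
    intro t
    ext z
    simp only [C, γ, Finset.mem_insert, Finset.mem_image, Finset.mem_univ, true_and]
    constructor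
    · rintro (rfl | ⟨i, rfl⟩)
      · exact .inr ⟨t, by simp⟩
      · by_cases hit : i = t
        · subst hit
          simp
        · refine .inr ⟨i, ?_⟩
          have : i.1 ≠ t.1 := fun h => hit (Fin.ext h)
          split_ifs <;> first | rfl | omega
    · rintro (rfl | ⟨i, rfl⟩)
      · exact .inr ⟨t, by simp⟩
      · by_cases hit : i = t
        · subst hit
          simp
        · refine .inr ⟨i, ?_⟩
          have : i.1 ≠ t.1 := fun h => hit (Fin.ext h)
          split_ifs <;> first | rfl | omega
  -- The sign of `C t ∪ {β t}` stays `-η'`, because the first change would show in `C t ∪ {lo}`.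
  have hsign : ∀ t : ℕ, ∀ ht : t < k + 1, sgn (insert (β ⟨t, ht⟩) (C t)) = -η' := by
    intro t
    induction t with
    | zero =>
      intro ht
      have := Finset.mem_Icc.1 (hβB ⟨0, ht⟩)
      rw [hC0]
      exact hr _ (by omega) (by omega)
    | succ t ih =>
      intro ht
      have h1 := ih (by omega)
      rw [hstep ⟨t, by omega⟩] at h1
      by_contra hne
      have hα1 := Finset.mem_Icc.1 (hαA ⟨t, by omega⟩)
      have hβ1 := Finset.mem_Icc.1 (hβB ⟨t + 1, ht⟩)
      have hnot : ∀ s (z : ℕ), (∀ i, γ s i ≠ z) → z ∉ C s := by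
        intro s z hz hm
        obtain ⟨i, -, hi⟩ := Finset.mem_image.1 hm
        exact hz i hi
      refine h (C (t + 1)) ((hCsub _).trans (Finset.Icc_subset_Icc ha.le hb)) (hCc _) lo
        (α ⟨t, by omega⟩) (β ⟨t + 1, ht⟩) le_rfl (by omega) (hαβ _ _) (by omega) ?_ ?_ ?_ ⟨?_, ?_⟩
      · intro hm
        have := Finset.mem_Icc.1 (hCsub _ hm)
        omega
      · refine hnot _ _ fun i hi => ?_
        have := hαβ ⟨t, by omega⟩ i
        simp only [γ] at hi
        split_ifs at hi with hlt
        · omega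
        · have := congrArg Fin.val (α.injective hi)
          simp at this
          omega
      · refine hnot _ _ fun i hi => ?_
        have := hαβ i ⟨t + 1, ht⟩
        simp only [γ] at hi
        split_ifs at hi with hlt
        · have := congrArg Fin.val (β.injective hi)
          simp at this
          omega
        · omega
      · have h2 := hσ (C (t + 1)) (hCsub _) (hCc _)
        simp only at h2 h1 ⊢
        rw [h1, h2]
        exact units_ne_neg_self η'
      · simp only at h1 ⊢
        rw [h1]
        exact fun h => hne h.symm
  have hlast := hsign k (by omega)
  have hα1 := Finset.mem_Icc.1 (hαA ⟨k, by omega⟩)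
  rw [hstep ⟨k, by omega⟩] at hlast
  simp only [hCk] at hlast
  rw [hl' _ (by omega) (by omega)] at hlast
  exact units_ne_neg_self η' hlast

/-- A flip `k`-sequence has at most `3 * 2 ^ k - 2` pairwise disjoint non-homogeneous intervals.
In the link of the first element, the second and the third of them merge, the fourth and the fifth,
and so on; the first one is given up, since it may contain that element. -/
theorem IsFlipOn.card_not_isHomogeneous_le (k : ℕ) :
    ∀ {lo n r : ℕ} {sgn : Finset ℕ → ℤˣ} {u v : ℕ → ℕ}, IsFlipOn k lo n sgn → lo ≤ u 0 →
      (∀ j < r, u j ≤ v j) → (∀ j, j + 1 < r → v j < u (j + 1)) → (∀ j < r, v j ≤ n) →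
      (∀ j < r, ¬ IsHomogeneous k sgn (u j) (v j)) → r + 2 ≤ 3 * 2 ^ k := by
  induction k with
  | zero =>
    intro lo n r sgn u v h hlo huv hsep hn hnh
    by_contra! hr
    simp only [pow_zero, mul_one] at hr
    obtain ⟨A, hA, hc, i, hi, j, hj, hij, -, -, hne⟩ :=
      exists_exchange_of_not_isHomogeneous (hnh 0 (by omega))
    obtain ⟨A', hA', hc', i', hi', j', hj', hij', -, -, hne'⟩ :=
      exists_exchange_of_not_isHomogeneous (hnh 1 (by omega))
    obtain rfl := Finset.card_eq_zero.1 hc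
    obtain rfl := Finset.card_eq_zero.1 hc'
    rw [Finset.mem_Icc] at hi hj hi' hj'
    have h0 := hsep 0 (by omega)
    have h1 := hn 1 (by omega)
    simp only [zero_add] at h0
    by_cases he : sgn (insert j ∅) = sgn (insert i' ∅)
    · exact h ∅ (by simp) rfl i i' j' (by omega) (by omega) hij' (by omega) (by simp) (by simp)
        (by simp) ⟨he ▸ hne, hne'⟩
    · exact h ∅ (by simp) rfl i j i' (by omega) hij (by omega) (by omega) (by simp) (by simp)
        (by simp) ⟨hne, he⟩
  | succ k ih =>
    intro lo n r sgn u v h hlo huv hsep hn hnh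
    rcases Nat.lt_or_ge r 2 with hr | hr
    · have := Nat.one_le_two_pow (n := k)
      rw [pow_succ]
      omega
    have hlo1 : lo < u 1 := by
      have := huv 0 (by omega)
      have := hsep 0 (by omega)
      simp only [zero_add] at this
      omega
    have hmono : ∀ j, 0 < j → j < r → lo < u j := by
      intro j hj
      induction j, hj using Nat.le_induction with
      | base => exact fun _ => hlo1
      | succ j hj ihj =>
        intro hjr
        have := ihj (by omega)
        have := huv j (by omega)
        have := hsep j hjr
        omega
    have hlon : lo ≤ n := by
      have := huv 1 (by omega)
      have := hn 1 (by omega)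
      omega
    have := ih (r := (r - 1) / 2) (u := fun j => u (2 * j + 1)) (v := fun j => v (2 * j + 2))
      (h.link hlon) hlo1
      (fun j hj => by
        have h1 := huv (2 * j + 1) (by omega)
        have h2 := huv (2 * j + 2) (by omega)
        have h3 := hsep (2 * j + 1) (by omega)
        have h4 : 2 * j + 1 + 1 = 2 * j + 2 := rfl
        rw [h4] at h3
        show u (2 * j + 1) ≤ v (2 * j + 2)
        omega)
      (fun j hj => hsep (2 * j + 2) (by omega)) (fun j hj => hn (2 * j + 2) (by omega))
      (fun j hj => h.not_isHomogeneous_link (hmono _ (by omega) (by omega))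
        (hsep (2 * j + 1) (by omega)) (hn (2 * j + 2) (by omega)) (hnh _ (by omega))
        (hnh _ (by omega)))
    rw [pow_succ]
    omega

/-! ### Greedy partitions -/

/-- An interval of at most `k + 1` elements is homogeneous. -/
theorem isHomogeneous_of_le {k a b : ℕ} (sgn : Finset ℕ → ℤˣ) (h : b ≤ a + k) :
    IsHomogeneous k sgn a b := by
  refine ⟨sgn (Finset.Icc a b), fun A hA hc => ?_⟩
  rw [Finset.eq_of_subset_of_card_le hA (by rw [Nat.card_Icc]; omega)]

theorem IsDivision.le {n m : ℕ} {e : ℕ → ℕ} (h : IsDivision n m e) {j : ℕ} (hj : j ≤ m) :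
    e j ≤ n := by
  induction hj using Nat.decreasingInduction with
  | self => exact h.2.1.le
  | of_succ j hj ih => exact (h.2.2 j hj).le.trans ih

/-- Every block but the last becomes non-homogeneous when it is extended by one element. Successive
extended blocks overlap, but every other one of them gives disjoint non-homogeneous intervals. -/
theorem flipBound_of_two_le {k : ℕ} (hk : 2 ≤ k) : FlipBound k (6 * 2 ^ k - 3) := by
  rintro n sgn - hflip m e ⟨hdiv, -, hmax⟩
  have hlong : ∀ j, j + 1 < m → e j + 1 < e (j + 1) := by
    intro j hj
    by_contra! hlt
    exact hmax j hj (isHomogeneous_of_le sgn (by omega))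
  have := IsFlipOn.card_not_isHomogeneous_le k (r := m / 2) (u := fun j => e (2 * j))
    (v := fun j => e (2 * j + 1) + 1) hflip.isFlipOn (Nat.zero_le _)
    (fun j hj => (hdiv.2.2 (2 * j) (by omega)).le.trans (Nat.le_succ _))
    (fun j hj => hlong (2 * j + 1) (by omega))
    (fun j hj => (hdiv.2.2 (2 * j + 1) (by omega)).trans_le (hdiv.le (by omega)))
    (fun j hj => hmax (2 * j) (by omega))
  omega

/-- Two successive elements always form a homogeneous block if `k ≥ 2`, so the greedy choice never
gets stuck. -/
theorem exists_isGreedyPartition {k n : ℕ} (hk : 2 ≤ k) (hn : 1 ≤ n) (sgn : Finset ℕ → ℤˣ) :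
    ∃ m e, IsGreedyPartition k n sgn m e := by
  classical
  suffices H : ∀ N a, a < n → n - a = N → ∃ m, ∃ e : ℕ → ℕ,
      (e 0 = a ∧ e m = n ∧ ∀ j < m, e j < e (j + 1)) ∧
      (∀ j < m, IsHomogeneous k sgn (e j) (e (j + 1))) ∧
      ∀ j, j + 1 < m → ¬ IsHomogeneous k sgn (e j) (e (j + 1) + 1) from H _ 0 hn rfl
  intro N
  induction N using Nat.strong_induction_on with
  | _ N ih =>
    rintro a ha rfl
    have h1 : IsHomogeneous k sgn a (a + 1) := isHomogeneous_of_le sgn (by omega)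
    set b := Nat.findGreatest (IsHomogeneous k sgn a) n with hb
    have hab : a + 1 ≤ b := Nat.le_findGreatest (by omega) h1
    have hbh : IsHomogeneous k sgn a b :=
      Nat.findGreatest_spec (P := IsHomogeneous k sgn a) (m := a + 1) (by omega) h1
    have hbn : b ≤ n := Nat.findGreatest_le n
    rcases hbn.eq_or_lt with hbn | hbn
    · refine ⟨1, fun j => if j = 0 then a else n, ⟨by simp, by simp, ?_⟩, ?_, ?_⟩
      · intro j hj
        obtain rfl : j = 0 := by omega
        simpa using ha
      · intro j hj
        obtain rfl : j = 0 := by omega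
        simpa [hbn] using hbh
      · intro j hj
        omega
    · obtain ⟨m, e, ⟨he0, hem, hmono⟩, hhom, hmax⟩ := ih (n - b) (by omega) b hbn rfl
      have hbmax : ¬ IsHomogeneous k sgn a (b + 1) :=
        Nat.findGreatest_is_greatest (Nat.lt_succ_self b) hbn
      refine ⟨m + 1, fun j => Nat.casesOn j a e, ⟨rfl, hem, ?_⟩, ?_, ?_⟩
      · rintro (_ | j) hj
        · show a < e 0
          omega
        · exact hmono j (by omega)
      · rintro (_ | j) hj
        · show IsHomogeneous k sgn a (e 0)
          rwa [he0]
        · exact hhom j (by omega)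
      · rintro (_ | j) hj
        · show ¬ IsHomogeneous k sgn a (e 0 + 1)
          rwa [he0]
        · exact hmax j (by omega)

/-- The explicit bound grows at least fourfold in each step. -/
theorem six_mul_two_pow_sub_le_explicitBound {d : ℕ} (hd : 2 ≤ d) :
    ((6 * 2 ^ d - 3 : ℕ) : ℚ) ≤ explicitBound d := by
  have h : (6 * 2 ^ d - 3 : ℚ) ≤ explicitBound d := by
    induction d, hd using Nat.le_induction with
    | base => norm_num [explicitBound]
    | succ d hd ih =>
      obtain ⟨k, rfl⟩ : ∃ k, d = k + 1 := ⟨d - 1, by omega⟩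
      have hk : (0 : ℚ) < (k : ℚ) + 2 := by positivity
      have h2 : (1 : ℚ) ≤ 2 ^ (k + 1) := one_le_pow₀ (by norm_num)
      have : 4 * explicitBound (k + 1) ≤
          (4 * ((k : ℚ) + 2) + 10) * explicitBound (k + 1) / ((k : ℚ) + 2) := by
        rw [le_div_iff₀ hk]
        nlinarith
      rw [show explicitBound (k + 1 + 1) =
        1 + (4 * ((k : ℚ) + 2) + 10) * explicitBound (k + 1) / ((k : ℚ) + 2) from rfl, pow_succ]
      linarith
  have h1 : 3 ≤ 6 * 2 ^ d := by
    have := Nat.one_le_two_pow (n := d)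
    omega
  push_cast [Nat.cast_sub h1]
  exact h

/-! ### Orientations -/

/-- The vector `(1, x)` of `ℝ^(d + 1)`. Affine functionals of `x` are the linear functionals
of `(1, x)`. -/
noncomputable def homogenize {d : ℕ} (x : EuclideanSpace ℝ (Fin d)) : Fin (d + 1) → ℝ :=
  Fin.cons 1 (fun i => x i)

/-- The determinant with rows `(1, q i)`; its sign is the orientation of the simplex with
vertices `q i`. -/
noncomputable def orient {d : ℕ} (q : Fin (d + 1) → EuclideanSpace ℝ (Fin d)) : ℝ :=
  Matrix.det (Matrix.of fun i => homogenize (q i))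

/-- The orientation of the points `p a`, `a ∈ A`, in increasing order of their indices, for a set
`A` of `d + 1` indices. It is `-1` for degenerate simplices, and `1` if `A` has a different number
of elements. -/
noncomputable def orientSign {d : ℕ} (p : ℕ → EuclideanSpace ℝ (Fin d)) (A : Finset ℕ) : ℤˣ :=
  if h : A.card = d + 1 then
    if 0 < orient (fun i => p (A.orderEmbOfFin h i)) then 1 else -1
  else 1

theorem homogenize_lineMap {d : ℕ} (x y : EuclideanSpace ℝ (Fin d)) (t : ℝ) :
    homogenize (AffineMap.lineMap x y t) = (1 - t) • homogenize x + t • homogenize y := by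
  ext i
  refine Fin.cases ?_ (fun i => ?_) i
  · simp [homogenize]
  · simp [homogenize, AffineMap.lineMap_apply_module]

/-- Every linear functional of `(1, x)` is an affine functional of `x`. -/
theorem exists_inner_sub_eq {d : ℕ} (f : (Fin (d + 1) → ℝ) →ₗ[ℝ] ℝ) :
    ∃ (u : EuclideanSpace ℝ (Fin d)) (c : ℝ), ∀ x, f (homogenize x) = inner ℝ u x - c := by
  refine ⟨WithLp.toLp 2 fun i => f (Pi.single i.succ 1), -f (Pi.single 0 1), fun x => ?_⟩
  rw [LinearMap.pi_apply_eq_sum_univ f, Fin.sum_univ_succ]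
  have : ∀ i : Fin (d + 1), (fun j => if i = j then (1 : ℝ) else 0) = Pi.single i 1 := by
    intro i
    ext j
    simp [Pi.single_apply, eq_comm]
  simp [homogenize, this, PiLp.inner_apply, add_comm]

theorem orient_eq_zero_of_hyperplane {d : ℕ} {q : Fin (d + 1) → EuclideanSpace ℝ (Fin d)}
    {u : EuclideanSpace ℝ (Fin d)} {c : ℝ} (hu : u ≠ 0) (hq : ∀ i, q i ∈ hyperplane u c) :
    orient q = 0 := by
  refine Matrix.exists_mulVec_eq_zero_iff.1 ⟨Fin.cons (-c) (fun i => u i), ?_, ?_⟩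
  · intro h
    apply hu
    ext i
    simpa using congrFun h i.succ
  · ext i
    have h : inner ℝ u (q i) = c := hq i
    simp only [PiLp.inner_apply, RCLike.inner_apply, conj_trivial] at h
    simp [Matrix.mulVec, dotProduct, homogenize, Fin.sum_univ_succ, h]

theorem orient_ne_zero {d n : ℕ} {p : ℕ → EuclideanSpace ℝ (Fin d)} (hp : InGeneralPosition p n)
    {c : Fin (d + 1) → ℕ} (hc : StrictMono c) (hn : ∀ i, c i ≤ n) :
    orient (fun i => p (c i)) ≠ 0 := by
  classical
  intro h0
  obtain ⟨w, hw, hw0⟩ := Matrix.exists_vecMul_eq_zero_iff.2 h0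
  have hind : AffineIndependent ℝ (fun i => p (c i)) := by
    have h := hp (Finset.univ.image c) (fun z hz => by
      obtain ⟨i, -, rfl⟩ := Finset.mem_image.1 hz
      exact Finset.mem_range.2 (Nat.lt_succ_of_le (hn i)))
      (by simp [Finset.card_image_of_injective _ hc.injective])
    let ι : Fin (d + 1) ↪ (Finset.univ.image c : Finset ℕ) :=
      ⟨fun i => ⟨c i, Finset.mem_image_of_mem c (Finset.mem_univ i)⟩, fun i j hij =>
        hc.injective (congrArg Subtype.val hij)⟩
    exact h.comp_embedding ι
  have hcoord : ∀ k, ∑ i, w i * homogenize (p (c i)) k = 0 := fun k => by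
    simpa [Matrix.vecMul, dotProduct] using congrFun hw0 k
  refine hw (funext fun i => affineIndependent_iff.1 hind Finset.univ w ?_ ?_ i (Finset.mem_univ i))
  · simpa [homogenize] using hcoord 0
  · ext k
    simpa [homogenize] using hcoord k.succ

theorem orientSign_mul_orient_pos {d n : ℕ} {p : ℕ → EuclideanSpace ℝ (Fin d)}
    (hp : InGeneralPosition p n) {A : Finset ℕ} (hA : A.card = d + 1) {c : Fin (d + 1) → ℕ}
    (hc : StrictMono c) (hn : ∀ i, c i ≤ n) (hcA : ∀ i, c i ∈ A) :
    0 < (((orientSign p A : ℤˣ) : ℤ) : ℝ) * orient (fun i => p (c i)) := by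
  have h := orient_ne_zero hp hc hn
  rw [orientSign, dif_pos hA, ← Finset.orderEmbOfFin_unique hA hcA hc]
  split_ifs with hpos
  · simpa using hpos
  · simpa using lt_of_le_of_ne (not_lt.1 hpos) h

/-! ### Homogeneous blocks are convex -/

theorem homogenize_polyPath {d : ℕ} (p : ℕ → EuclideanSpace ℝ (Fin d)) (t : ℝ) :
    homogenize (polyPath p t) = (1 - (t - ⌊t⌋₊)) • homogenize (p ⌊t⌋₊) +
      (t - ⌊t⌋₊) • homogenize (p (⌊t⌋₊ + 1)) :=
  homogenize_lineMap _ _ _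

theorem inner_lineMap {d : ℕ} (u x y : EuclideanSpace ℝ (Fin d)) (t : ℝ) :
    inner ℝ u (AffineMap.lineMap x y t) = (1 - t) * inner ℝ u x + t * inner ℝ u y := by
  rw [AffineMap.lineMap_apply_module, inner_add_right, inner_smul_right, inner_smul_right]

/-- If a hyperplane contains two points of an edge, it contains the edge; so hyperplane sections
that contain no edge have at most one point with a given integer part of the parameter. -/
theorem floor_ne_floor_of_mem_hyperplane {d a b : ℕ} {p : ℕ → EuclideanSpace ℝ (Fin d)}
    {u : EuclideanSpace ℝ (Fin d)} {c : ℝ}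
    (hedge : ∀ i : ℕ, a ≤ i → i < b → ¬ segment ℝ (p i) (p (i + 1)) ⊆ hyperplane u c) {s t : ℝ}
    (has : a ≤ s) (hst : s < t) (htb : t ≤ b) (hs : polyPath p s ∈ hyperplane u c)
    (ht : polyPath p t ∈ hyperplane u c) : ⌊s⌋₊ ≠ ⌊t⌋₊ := by
  intro hfl
  have hs' : inner ℝ u (polyPath p s) = c := hs
  have ht' : inner ℝ u (polyPath p t) = c := ht
  rw [polyPath, inner_lineMap] at hs' ht'
  rw [← hfl] at ht'
  have heq : inner ℝ u (p (⌊s⌋₊ + 1)) = inner ℝ u (p ⌊s⌋₊) := by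
    have : (t - s) * (inner ℝ u (p (⌊s⌋₊ + 1)) - inner ℝ u (p ⌊s⌋₊)) = 0 := by linarith
    rcases mul_eq_zero.1 this with h | h <;> linarith
  rw [heq] at hs'
  have hc : inner ℝ u (p ⌊s⌋₊) = c := by linarith
  refine hedge ⌊s⌋₊ (Nat.le_floor has) ?_ fun x hx => ?_
  · exact_mod_cast (Nat.floor_le ((Nat.cast_nonneg a).trans has)).trans_lt (hst.trans_le htb)
  · rw [segment_eq_image_lineMap] at hx
    obtain ⟨r, -, rfl⟩ := hx
    show inner ℝ u _ = c
    rw [inner_lineMap, heq, hc]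
    ring

/-- If all simplices on vertices of the path have the same orientation, then so have, by
multilinearity, all simplices on points of different edges, and these are not contained in a
hyperplane. -/
theorem isCrossing_of_isHomogeneous {d n a b : ℕ} {p : ℕ → EuclideanSpace ℝ (Fin d)}
    (hp : InGeneralPosition p n) (hb : b ≤ n) (h : IsHomogeneous d (orientSign p) a b) :
    IsCrossing d p a b := by
  classical
  obtain ⟨σ, hσ⟩ := h
  intro u c hu hedge
  by_contra! hcard
  obtain ⟨T, hT, hTc⟩ := Set.exists_subset_encard_eq (Order.add_one_le_of_lt hcard)
  have hTf : T.Finite := Set.finite_of_encard_eq_coe (k := d + 1) (by simpa using hTc)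
  have hFc : hTf.toFinset.card = d + 1 := by
    rw [hTf.encard_eq_coe_toFinset_card] at hTc
    exact_mod_cast hTc
  set t := hTf.toFinset.orderEmbOfFin hFc with ht
  have htT : ∀ j, t j ∈ T := fun j =>
    hTf.mem_toFinset.1 (hTf.toFinset.orderEmbOfFin_mem hFc j)
  have hta : ∀ j, (a : ℝ) ≤ t j := fun j => (hT (htT j)).1.1
  have htb : ∀ j, t j ≤ b := fun j => (hT (htT j)).1.2
  have hth : ∀ j, polyPath p (t j) ∈ hyperplane u c := fun j => (hT (htT j)).2
  have ht0 : ∀ j, 0 ≤ t j := fun j => (Nat.cast_nonneg a).trans (hta j)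
  let i : Fin (d + 1) → ℕ := fun j => ⌊t j⌋₊
  let lam : Fin (d + 1) → ℝ := fun j => t j - i j
  have hlam0 : ∀ j, 0 ≤ lam j := fun j => sub_nonneg.2 (Nat.floor_le (ht0 j))
  have hlam1 : ∀ j, 0 < 1 - lam j := fun j => by
    have := Nat.lt_floor_add_one (t j)
    simp only [lam, i]
    linarith
  have hi : StrictMono i := fun j j' hjj => lt_of_le_of_ne
    (Nat.floor_le_floor (t.monotone hjj.le))
    (floor_ne_floor_of_mem_hyperplane hedge (hta j) (t.strictMono hjj) (htb j') (hth j) (hth j'))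
  have hia : ∀ j, a ≤ i j := fun j => Nat.le_floor (hta j)
  have hib : ∀ j, i j ≤ b := fun j => Nat.floor_le_of_le (htb j)
  -- `s` is the set of the points that are replaced by the initial vertex of their edge.
  let v : Finset (Fin (d + 1)) → Fin (d + 1) → ℕ := fun s j => if j ∈ s then i j else i j + 1
  let w : Finset (Fin (d + 1)) → Fin (d + 1) → ℝ := fun s j => if j ∈ s then 1 - lam j else lam j
  -- If `t j = b`, the replacement `i j + 1` lies beyond the path, but then its weight is zero.
  have hexp : orient (fun j => polyPath p (t j)) =
      ∑ s, (∏ j, w s j) * orient (fun j => p (v s j)) := by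
    have h1 : (Matrix.of fun j => homogenize (polyPath p (t j))) =
        (fun j => (1 - lam j) • homogenize (p (i j))) +
          fun j => lam j • homogenize (p (i j + 1)) := by
      funext j
      exact homogenize_polyPath p (t j)
    have h2 := (Matrix.detRowAlternating (R := ℝ) (n := Fin (d + 1))).toMultilinearMap.map_add_univ
      (fun j => (1 - lam j) • homogenize (p (i j))) (fun j => lam j • homogenize (p (i j + 1)))
    rw [orient, h1]
    refine h2.trans (Finset.sum_congr rfl fun s _ => ?_)
    have h3 := (Matrix.detRowAlternating (R := ℝ) (n := Fin (d + 1))).toMultilinearMap.map_smul_univ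
      (w s) (fun j => homogenize (p (v s j)))
    refine Eq.trans (congrArg _ (funext fun j => ?_)) h3
    by_cases hj : j ∈ s <;> simp [Finset.piecewise, w, v, hj]
  have hpos : ∀ s, (∀ j, v s j ≤ b) → StrictMono (v s) →
      0 < ((σ : ℤ) : ℝ) * orient (fun j => p (v s j)) := by
    intro s hvb hv
    have hc : (Finset.univ.image (v s)).card = d + 1 := by
      simp [Finset.card_image_of_injective _ hv.injective]
    rw [← hσ (Finset.univ.image (v s)) ?_ hc]
    · exact orientSign_mul_orient_pos hp hc hv (fun j => (hvb j).trans hb) (fun j =>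
        Finset.mem_image_of_mem _ (Finset.mem_univ j))
    · intro z hz
      obtain ⟨j, -, rfl⟩ := Finset.mem_image.1 hz
      refine Finset.mem_Icc.2 ⟨?_, hvb j⟩
      have := hia j
      simp only [v]
      split_ifs <;> omega
  have hw0 : ∀ s j, 0 ≤ w s j := fun s j => by
    simp only [w]
    split_ifs
    exacts [(hlam1 j).le, hlam0 j]
  have hnonneg : ∀ s, 0 ≤ ((σ : ℤ) : ℝ) * ((∏ j, w s j) * orient (fun j => p (v s j))) := by
    intro s
    rcases (Finset.prod_nonneg fun j _ => hw0 s j).eq_or_lt with h0 | h0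
    · rw [← h0]
      simp
    have hvb : ∀ j, v s j ≤ b := by
      intro j
      have hwj : w s j ≠ 0 := fun hz => h0.ne' (Finset.prod_eq_zero (Finset.mem_univ j) hz)
      by_cases hj : j ∈ s
      · simpa [v, hj] using hib j
      · have hlt : (i j : ℝ) < b := by
          have : lam j ≠ 0 := by simpa [w, hj] using hwj
          have := (hlam0 j).lt_of_ne' this
          have := htb j
          simp only [lam] at *
          linarith
        simp only [v, hj, if_false]
        exact_mod_cast hlt
    -- The indices `v s j` increase weakly with `j`, and two equal ones give a zero determinant.
    by_cases hv : Function.Injective (v s)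
    · have hvm : StrictMono (v s) := by
        refine Monotone.strictMono_of_injective (fun j j' hjj => ?_) hv
        rcases hjj.eq_or_lt with rfl | hjj
        · exact le_rfl
        · have := hi hjj
          simp only [v]
          split_ifs <;> omega
      rw [mul_left_comm]
      exact (mul_pos h0 (hpos s hvb hvm)).le
    · rw [Function.not_injective_iff] at hv
      obtain ⟨j, j', hjj, hne⟩ := hv
      have : orient (fun j => p (v s j)) = 0 :=
        Matrix.det_zero_of_row_eq hne (congrArg (fun i => homogenize (p i)) hjj)
      simp [this]
  have hsum : 0 < ((σ : ℤ) : ℝ) * orient (fun j => polyPath p (t j)) := by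
    rw [hexp, Finset.mul_sum]
    refine Finset.sum_pos' (fun s _ => hnonneg s) ⟨Finset.univ, Finset.mem_univ _, ?_⟩
    rw [mul_left_comm]
    refine mul_pos (Finset.prod_pos fun j _ => by simpa [w] using hlam1 j)
      (hpos _ (fun j => by simpa [v] using hib j) ?_)
    simpa [v] using hi
  rw [orient_eq_zero_of_hyperplane hu hth, mul_zero] at hsum
  exact hsum.false

/-! ### Orientations of a path with few crossings -/

theorem card_filter_lt_orderEmbOfFin {m : ℕ} {B : Finset ℕ} (h : B.card = m) (r : Fin m) :
    (B.filter (· < B.orderEmbOfFin h r)).card = r := by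
  have : B.filter (· < B.orderEmbOfFin h r) = (Finset.Iio r).map (B.orderEmbOfFin h).toEmbedding := by
    ext z
    simp only [Finset.mem_filter, Finset.mem_map, Finset.mem_Iio, RelEmbedding.coe_toEmbedding]
    constructor
    · rintro ⟨hz, hlt⟩
      obtain ⟨i, rfl⟩ : z ∈ Set.range (B.orderEmbOfFin h) := by
        rw [Finset.range_orderEmbOfFin]
        exact hz
      exact ⟨i, (B.orderEmbOfFin h).lt_iff_lt.1 hlt, rfl⟩
    · rintro ⟨i, hi, rfl⟩
      exact ⟨B.orderEmbOfFin_mem h i, (B.orderEmbOfFin h).strictMono hi⟩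
  rw [this, Finset.card_map, Fin.card_Iio]

/-- The determinant of the matrix with first row `x` and further rows `R`, as a linear function
of `x`. -/
noncomputable def cofactor {d : ℕ} (R : Fin d → Fin (d + 1) → ℝ) : (Fin (d + 1) → ℝ) →ₗ[ℝ] ℝ :=
  ∑ k : Fin (d + 1), ((-1) ^ (k : ℕ) * Matrix.det (Matrix.of fun a b => R a (k.succAbove b))) •
    LinearMap.proj k

theorem det_eq_cofactor {d : ℕ} (M : Matrix (Fin (d + 1)) (Fin (d + 1)) ℝ) (r : Fin (d + 1)) :
    M.det = (-1) ^ (r : ℕ) * cofactor (fun a => M (r.succAbove a)) (M r) := by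
  rw [Matrix.det_succ_row M r, cofactor, LinearMap.sum_apply, Finset.mul_sum]
  refine Finset.sum_congr rfl fun k _ => ?_
  have : M.submatrix r.succAbove k.succAbove =
    Matrix.of fun a b => M (r.succAbove a) (k.succAbove b) := rfl
  rw [this, pow_add]
  simp only [LinearMap.smul_apply, LinearMap.proj_apply, smul_eq_mul]
  ring

theorem cofactor_eq_zero {d : ℕ} (R : Fin d → Fin (d + 1) → ℝ) (a : Fin d) :
    cofactor R (R a) = 0 := by
  let M : Matrix (Fin (d + 1)) (Fin (d + 1)) ℝ := Matrix.of (Fin.cons (R a) R)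
  have h : M.det = (-1) ^ 0 * cofactor R (R a) := det_eq_cofactor M 0
  have h0 : M.det = 0 := Matrix.det_zero_of_row_eq (Fin.succ_ne_zero a).symm rfl
  rwa [h0, pow_zero, one_mul, eq_comm] at h

/-- The side of the hyperplane through the points `p a`, `a ∈ A`, on which `p z` lies, compared with
the orientation of `A ∪ {z}`. -/
theorem orientSign_insert_mul_cofactor_pos {d n : ℕ} {p : ℕ → EuclideanSpace ℝ (Fin d)}
    (hp : InGeneralPosition p n) {A : Finset ℕ} (hA : A ⊆ Finset.range (n + 1)) (hc : A.card = d)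
    {z : ℕ} (hz : z ≤ n) (hzA : z ∉ A) :
    0 < (((orientSign p (insert z A) : ℤˣ) : ℤ) : ℝ) * ((-1) ^ (A.filter (· < z)).card *
      cofactor (fun a => homogenize (p (A.orderEmbOfFin hc a))) (homogenize (p z))) := by
  have hBc : (insert z A).card = d + 1 := by rw [Finset.card_insert_of_notMem hzA, hc]
  set β := (insert z A).orderEmbOfFin hBc with hβ
  have hβB : ∀ r, β r ∈ insert z A := fun r => Finset.orderEmbOfFin_mem _ hBc r
  have hβn : ∀ r, β r ≤ n := fun r => by
    rcases Finset.mem_insert.1 (hβB r) with h | h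
    · omega
    · exact Nat.lt_succ_iff.1 (Finset.mem_range.1 (hA h))
  obtain ⟨r, hr⟩ : z ∈ Set.range β := by
    rw [hβ, Finset.range_orderEmbOfFin]
    simp
  have hα : (fun a => β (r.succAbove a)) = A.orderEmbOfFin hc := by
    refine Finset.orderEmbOfFin_unique hc (fun a => ?_)
      (β.strictMono.comp (Fin.strictMono_succAbove r))
    refine (Finset.mem_insert.1 (hβB _)).resolve_left fun h => ?_
    exact Fin.succAbove_ne r a (β.injective (h.trans hr.symm))
  have hrank : (A.filter (· < z)).card = r := by
    rw [← card_filter_lt_orderEmbOfFin hBc r, ← hβ, hr, Finset.filter_insert, if_neg (lt_irrefl z)]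
  have h := orientSign_mul_orient_pos hp hBc β.strictMono hβn hβB
  have hdet : orient (fun i => p (β i)) = (-1) ^ (r : ℕ) *
      cofactor (fun a => homogenize (p (β (r.succAbove a)))) (homogenize (p (β r))) :=
    det_eq_cofactor _ r
  have hα' : ∀ a, A.orderEmbOfFin hc a = β (r.succAbove a) := fun a => (congrFun hα a).symm
  rw [hdet, hr] at h
  simp only [hα', hrank]
  exact h

/-- An affine functional can take any prescribed values at `d + 1` of the vertices. -/
theorem exists_linearMap_homogenize_eq {d n : ℕ} {p : ℕ → EuclideanSpace ℝ (Fin d)}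
    (hp : InGeneralPosition p n) {B : Finset ℕ} (hB : B ⊆ Finset.range (n + 1))
    (hc : B.card = d + 1) (y : ℕ → ℝ) :
    ∃ g : (Fin (d + 1) → ℝ) →ₗ[ℝ] ℝ, ∀ z ∈ B, g (homogenize (p z)) = y z := by
  set β := B.orderEmbOfFin hc with hβ
  have hdet := orient_ne_zero hp β.strictMono
    (fun r => Nat.lt_succ_iff.1 (Finset.mem_range.1 (hB (B.orderEmbOfFin_mem hc r))))
  set M : Matrix (Fin (d + 1)) (Fin (d + 1)) ℝ := Matrix.of fun i => homogenize (p (β i)) with hM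
  refine ⟨(dotProductBilin ℝ ℝ).flip (M⁻¹.mulVec fun i => y (β i)), fun z hz => ?_⟩
  obtain ⟨r, rfl⟩ : z ∈ Set.range β := by
    rw [hβ, Finset.range_orderEmbOfFin]
    exact hz
  have : M.mulVec (M⁻¹.mulVec fun i => y (β i)) = fun i => y (β i) := by
    rw [Matrix.mulVec_mulVec, Matrix.mul_nonsing_inv _ (isUnit_iff_ne_zero.2 hdet),
      Matrix.one_mulVec]
  exact congrFun this r

theorem exists_consecutive_mul_neg {F : ℕ → ℝ} {a b : ℕ} (hab : a < b) (hF : ∀ v ≤ b, F v ≠ 0)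
    (h : F a * F b < 0) : ∃ i, a ≤ i ∧ i < b ∧ F i * F (i + 1) < 0 := by
  by_contra! hcon
  have : ∀ v, a ≤ v → v ≤ b → 0 < F a * F v := by
    intro v hv
    induction v, hv using Nat.le_induction with
    | base => exact fun hb => mul_self_pos.2 (hF a hb)
    | succ v hv ih =>
      intro hvb
      have h1 := ih (by omega)
      have h2 := (hcon v hv (by omega)).lt_of_ne'
        (mul_ne_zero (hF v (by omega)) (hF (v + 1) hvb))
      have h3 := mul_pos h1 h2
      have h4 : F a * F v * (F v * F (v + 1)) = F v ^ 2 * (F a * F (v + 1)) := by ring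
      rw [h4] at h3
      exact pos_of_mul_pos_right h3 (sq_nonneg _)
  exact (this b hab.le le_rfl).not_gt h

/-- A path whose vertices lie alternately on the two sides of a hyperplane crosses it in between. -/
theorem not_isCrossing_of_alternating {d n m : ℕ} {p : ℕ → EuclideanSpace ℝ (Fin d)}
    {f : (Fin (d + 1) → ℝ) →ₗ[ℝ] ℝ} (hf : ∀ v ≤ n, f (homogenize (p v)) ≠ 0)
    {t : Fin (m + 2) → ℕ} (ht : StrictMono t) (htn : ∀ k, t k ≤ n)
    (halt : ∀ k : Fin (m + 1),
      f (homogenize (p (t k.castSucc))) * f (homogenize (p (t k.succ))) < 0) :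
    ¬ IsCrossing m p 0 n := by
  intro hcr
  set F : ℕ → ℝ := fun v => f (homogenize (p v)) with hF
  obtain ⟨u, c, huc⟩ := exists_inner_sub_eq f
  have hu : u ≠ 0 := by
    rintro rfl
    have h := halt 0
    simp only [huc, inner_zero_left] at h
    exact (mul_self_nonneg _).not_gt h
  have hedge : ∀ i : ℕ, 0 ≤ i → i < n → ¬ segment ℝ (p i) (p (i + 1)) ⊆ hyperplane u c := by
    intro i _ hi hsub
    have h : inner ℝ u (p i) = c := hsub (left_mem_segment ℝ _ _)
    exact hf i hi.le (by rw [huc, h, sub_self])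
  have hex : ∀ k : Fin (m + 1), ∃ i, t k.castSucc ≤ i ∧ i < t k.succ ∧ F i * F (i + 1) < 0 :=
    fun k => exists_consecutive_mul_neg (ht (Fin.castSucc_lt_succ (i := k)))
      (fun v hv => hf v (hv.trans (htn _))) (halt k)
  choose i hti hit hneg using hex
  set r : Fin (m + 1) → ℝ := fun k => F (i k) / (F (i k) - F (i k + 1)) with hr
  have hr01 : ∀ k, 0 < r k ∧ r k < 1 := by
    intro k
    rcases mul_neg_iff.1 (hneg k) with ⟨h1, h2⟩ | ⟨h1, h2⟩
    · have h3 : 0 < F (i k) - F (i k + 1) := by linarith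
      exact ⟨div_pos h1 h3, (div_lt_one h3).2 (by linarith)⟩
    · have h3 : F (i k) - F (i k + 1) < 0 := by linarith
      exact ⟨div_pos_of_neg_of_neg h1 h3, (div_lt_one_of_neg h3).2 (by linarith)⟩
  set θ : Fin (m + 1) → ℝ := fun k => i k + r k with hθ
  have hfloor : ∀ k, ⌊θ k⌋₊ = i k := fun k => by
    rw [Nat.floor_eq_iff (add_nonneg (Nat.cast_nonneg _) (hr01 k).1.le)]
    have h := hr01 k
    constructor <;> linarith
  have hθmono : StrictMono θ := by
    intro k k' hkk
    have h1 : i k + 1 ≤ i k' :=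
      (hit k).trans_le ((ht.monotone (Fin.succ_le_castSucc_iff.2 hkk)).trans (hti k'))
    have h2 : (i k : ℝ) + 1 ≤ i k' := by exact_mod_cast h1
    simp only [hθ]
    linarith [(hr01 k).2, (hr01 k').1]
  have hmem : Set.range θ ⊆ {t : ℝ | t ∈ Set.Icc ((0 : ℕ) : ℝ) (n : ℝ) ∧
      polyPath p t ∈ hyperplane u c} := by
    rintro _ ⟨k, rfl⟩
    have h1 : (i k : ℝ) + 1 ≤ n := by exact_mod_cast (hit k).trans_le (htn _)
    refine ⟨⟨?_, ?_⟩, ?_⟩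
    · rw [Nat.cast_zero]
      exact add_nonneg (Nat.cast_nonneg _) (hr01 k).1.le
    · simp only [hθ]
      linarith [(hr01 k).2]
    · show inner ℝ u (polyPath p (θ k)) = c
      rw [← sub_eq_zero, ← huc, homogenize_polyPath, hfloor, map_add, map_smul, map_smul]
      have h3 : F (i k) - F (i k + 1) ≠ 0 := fun h3 => by
        have := (hr01 k).1
        simp [hr, h3] at this
      show (1 - (↑(i k) + r k - ↑(i k))) * F (i k) + (↑(i k) + r k - ↑(i k)) * F (i k + 1) = 0
      simp only [hr]
      field_simp
      ring
  have h1 := (Set.encard_le_encard hmem).trans (hcr u c hu hedge)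
  rw [← Set.image_univ, hθmono.injective.encard_image, Set.encard_univ, ENat.card_eq_coe_fintype_card,
    Fintype.card_fin] at h1
  have h2 : m + 1 ≤ m := by exact_mod_cast h1
  omega

theorem neg_one_pow_mul_self_pos (m : ℕ) : (0 : ℝ) < (-1) ^ m * (-1) ^ m := by
  rw [← pow_add, Even.neg_one_pow ⟨m, rfl⟩]
  exact one_pos

/-- Three alternating signs for the same `d` vertices `A` give a hyperplane through these vertices
that can be tilted slightly so that `d + 3` vertices lie alternately on its two sides. -/
theorem isFlipSeq_orientSign {d n : ℕ} {p : ℕ → EuclideanSpace ℝ (Fin d)}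
    (hp : InGeneralPosition p n) (hcr : IsCrossing (d + 1) p 0 n) :
    IsFlipSeq d n (orientSign p) := by
  classical
  rintro A hA hc i j l hij hjl hln hiA hjA hlA ⟨hne, hne'⟩
  have hjsign : orientSign p (insert j A) = -orientSign p (insert i A) :=
    Int.units_ne_iff_eq_neg.1 hne.symm
  have hlsign : orientSign p (insert l A) = orientSign p (insert i A) :=
    (Int.units_eq_of_ne_of_ne hne hne').symm
  set τ : ℝ := (((orientSign p (insert i A) : ℤˣ) : ℤ) : ℝ) with hτ
  have hττ : τ * τ = 1 := by
    rw [hτ]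
    exact_mod_cast Int.units_coe_mul_self _
  set T := insert i (insert j (insert l A)) with hT
  have hTc : T.card = d + 1 + 2 := by
    rw [hT, Finset.card_insert_of_notMem, Finset.card_insert_of_notMem,
      Finset.card_insert_of_notMem hlA, hc]
    · simp [hjA]
      omega
    · simp [hiA]
      omega
  have hTn : ∀ z ∈ T, z ≤ n := by
    intro z hz
    simp only [hT, Finset.mem_insert] at hz
    rcases hz with rfl | rfl | rfl | hz
    · omega
    · omega
    · omega
    · exact Nat.lt_succ_iff.1 (Finset.mem_range.1 (hA hz))
  -- The rank of a vertex in `T`.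
  set rk : ℕ → ℕ := fun z => (T.filter (· < z)).card with hrk
  set φ := cofactor (fun a => homogenize (p (A.orderEmbOfFin hc a))) with hφ
  have hφA : ∀ z ∈ A, φ (homogenize (p z)) = 0 := by
    intro z hz
    obtain ⟨a, rfl⟩ : z ∈ Set.range (A.orderEmbOfFin hc) := by
      rw [Finset.range_orderEmbOfFin]
      exact hz
    exact cofactor_eq_zero _ a
  have hφne : ∀ z ≤ n, z ∉ A → φ (homogenize (p z)) ≠ 0 := by
    intro z hz hzA h0
    have := orientSign_insert_mul_cofactor_pos hp hA hc hz hzA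
    rw [← hφ, h0] at this
    simp at this
  -- Moving `z` to its place in `A ∪ {z}` costs a sign for every smaller element of `A`; together
  -- with the alternating orientations this makes `φ` alternate along `T`.
  have hφT : ∀ z ∈ T, z ∉ A → 0 < τ * (-1) ^ rk z * φ (homogenize (p z)) := by
    intro z hz hzA
    have h := orientSign_insert_mul_cofactor_pos hp hA hc (hTn z hz) hzA
    rw [← hφ] at h
    have hz' : z = i ∨ z = j ∨ z = l := by
      simp only [hT, Finset.mem_insert] at hz
      tauto
    rcases hz' with rfl | rfl | rfl
    · have : rk z = (A.filter (· < z)).card := by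
        simp [hrk, hT, Finset.filter_insert, hij.not_gt, (hij.trans hjl).not_gt]
      rw [this]
      linarith
    · have : rk z = (A.filter (· < z)).card + 1 := by
        simp only [hrk, hT, Finset.filter_insert, lt_irrefl, if_false, hij, if_true, hjl.not_gt]
        rw [Finset.card_insert_of_notMem (by simp [hiA])]
      rw [this, pow_succ]
      rw [hjsign] at h
      push_cast at h
      linarith
    · have : rk z = (A.filter (· < z)).card + 2 := by
        simp only [hrk, hT, Finset.filter_insert, lt_irrefl, if_false, hij.trans hjl, if_true, hjl]
        rw [Finset.card_insert_of_notMem (by simp [hiA, hij.ne]),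
          Finset.card_insert_of_notMem (by simp [hjA])]
      rw [this, pow_add]
      rw [hlsign] at h
      linarith
  obtain ⟨g, hg⟩ := exists_linearMap_homogenize_eq hp (B := insert i A)
    (Finset.insert_subset (Finset.mem_range.2 (by omega)) hA)
    (by rw [Finset.card_insert_of_notMem hiA, hc]) (fun z => τ * (-1) ^ rk z)
  -- `φ` vanishes exactly at the vertices in `A`; a small multiple of `g` gives these the right
  -- signs and changes no other sign.
  obtain ⟨ε, hε0, hε⟩ : ∃ ε : ℝ, 0 < ε ∧ ∀ v ∈ Finset.range (n + 1), v ∉ A →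
      |ε * g (homogenize (p v))| < |φ (homogenize (p v))| := by
    have h1 : ∀ᶠ ε : ℝ in nhdsWithin 0 (Set.Ioi 0), ∀ v ∈ Finset.range (n + 1), v ∉ A →
        |ε * g (homogenize (p v))| < |φ (homogenize (p v))| := by
      refine nhdsWithin_le_nhds ((Filter.eventually_all_finset _).2 fun v hv => ?_)
      by_cases hvA : v ∈ A
      · exact Filter.Eventually.of_forall fun ε h => (h hvA).elim
      have hcont : Continuous fun ε : ℝ => |ε * g (homogenize (p v))| := by fun_prop
      have hpos : |(0 : ℝ) * g (homogenize (p v))| < |φ (homogenize (p v))| := by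
        simpa using hφne v (Nat.lt_succ_iff.1 (Finset.mem_range.1 hv)) hvA
      exact (hcont.continuousAt.eventually_lt continuousAt_const hpos).mono fun ε h _ => h
    obtain ⟨ε, h, h0⟩ := (h1.and self_mem_nhdsWithin).exists
    exact ⟨ε, h0, h⟩
  set f := φ + ε • g with hf
  have hfapp : ∀ v, f (homogenize (p v)) =
      φ (homogenize (p v)) + ε * g (homogenize (p v)) := fun v => rfl
  have hfA : ∀ z ∈ A, 0 < τ * (-1) ^ rk z * f (homogenize (p z)) := by
    intro z hz
    rw [hfapp, hφA z hz, hg z (Finset.mem_insert_of_mem hz), zero_add]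
    have h1 : τ * (-1) ^ rk z * (ε * (τ * (-1) ^ rk z)) =
      (τ * τ) * ε * ((-1) ^ rk z * (-1) ^ rk z) := by ring
    rw [h1, hττ, one_mul]
    exact mul_pos hε0 (neg_one_pow_mul_self_pos _)
  have hsmall : ∀ v ≤ n, v ∉ A → 0 < φ (homogenize (p v)) * f (homogenize (p v)) := by
    intro v hv hvA
    have h1 := hε v (Finset.mem_range.2 (by omega)) hvA
    rw [hfapp]
    rcases lt_or_gt_of_ne (hφne v hv hvA) with h0 | h0
    · rw [abs_of_neg h0] at h1
      exact mul_pos_of_neg_of_neg h0 (by linarith [(abs_lt.1 h1).2])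
    · rw [abs_of_pos h0] at h1
      exact mul_pos h0 (by linarith [(abs_lt.1 h1).1])
  have hfT : ∀ z ∈ T, 0 < τ * (-1) ^ rk z * f (homogenize (p z)) := by
    intro z hz
    by_cases hzA : z ∈ A
    · exact hfA z hzA
    have h1 := mul_pos (hφT z hz hzA) (hsmall z (hTn z hz) hzA)
    have h2 : τ * (-1) ^ rk z * φ (homogenize (p z)) *
        (φ (homogenize (p z)) * f (homogenize (p z))) =
      φ (homogenize (p z)) ^ 2 * (τ * (-1) ^ rk z * f (homogenize (p z))) := by ring
    rw [h2] at h1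
    exact pos_of_mul_pos_right h1 (sq_nonneg _)
  refine not_isCrossing_of_alternating (f := f) (t := T.orderEmbOfFin hTc) ?_
    (T.orderEmbOfFin hTc).strictMono (fun k => hTn _ (T.orderEmbOfFin_mem hTc k)) ?_ hcr
  · intro v hv h0
    by_cases hvA : v ∈ A
    · have := hfA v hvA
      rw [h0, mul_zero] at this
      exact this.false
    · have := hsmall v hv hvA
      rw [h0, mul_zero] at this
      exact this.false
  · intro k
    have h1 := hfT _ (T.orderEmbOfFin_mem hTc k.castSucc)
    have h2 := hfT _ (T.orderEmbOfFin_mem hTc k.succ)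
    have hr1 : rk (T.orderEmbOfFin hTc k.castSucc) = k := card_filter_lt_orderEmbOfFin hTc _
    have hr2 : rk (T.orderEmbOfFin hTc k.succ) = k + 1 := card_filter_lt_orderEmbOfFin hTc _
    rw [hr1] at h1
    rw [hr2] at h2
    have h3 := mul_pos h1 h2
    generalize f (homogenize (p (T.orderEmbOfFin hTc k.castSucc))) = x at h3 ⊢
    generalize f (homogenize (p (T.orderEmbOfFin hTc k.succ))) = y at h3 ⊢
    have h4 : τ * (-1) ^ (k : ℕ) * x * (τ * (-1) ^ ((k : ℕ) + 1) * y) =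
        -(τ * τ * (((-1) ^ (k : ℕ) * (-1) ^ (k : ℕ)) * (x * y))) := by ring
    rw [h4, hττ, one_mul] at h3
    by_contra! hxy
    have := mul_nonneg (neg_one_pow_mul_self_pos (k : ℕ)).le hxy
    linarith

/-! ### The subdivision -/

/-- The greedy partition of the sequence of orientations is a subdivision into convex paths. -/
theorem FlipBound.subdivisionBound {d c : ℕ} (hd : 2 ≤ d) (h : FlipBound d c) :
    SubdivisionBound d c := by
  intro n p hn hp hcr
  obtain ⟨m, e, he⟩ := exists_isGreedyPartition hd hn (orientSign p)
  exact ⟨m, h n _ hn (isFlipSeq_orientSign hp hcr) m e he, e, he.1, fun j hj =>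
    isCrossing_of_isHomogeneous hp (he.1.le hj) (he.2.1 j hj)⟩

theorem theorem2 (d : ℕ) (hd : 2 ≤ d) :
    ∃ M : ℕ, SubdivisionBound d M ∧ (∀ c : ℕ, FlipBound d c → M ≤ c) ∧
      (M : ℚ) ≤ explicitBound d := by
  classical
  have hex : ∃ c, FlipBound d c := ⟨_, flipBound_of_two_le hd⟩
  refine ⟨Nat.find hex, (Nat.find_spec hex).subdivisionBound hd, fun c hc => Nat.find_min' hex hc,
    le_trans ?_ (six_mul_two_pow_sub_le_explicitBound hd)⟩
  exact_mod_cast Nat.find_min' hex (flipBound_of_two_le hd)
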